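/- \textbf{Setting.} For a finite family $\mathcal A=(A_1,\dots,A_n)$ of points of a metric space $(Y,\rho)$ let $S_{\mathcal A}(y)=\sum_i\rho(y,A_i)$, let $\Sigma(\mathcal A)$ be the set of points $y\in Y$ at which $S_{\mathcal A}$ attains its least value, let $d(y,\mathcal A)=(\rho(y,A_1),\dots,\rho(y,A_n))$, $\Omega(\mathcal A)=\{d(y,\mathcal A): y\in\Sigma(\mathcal A)\}$, and, for a vector $d$, $\Sigma_d(\mathcal A)=\{y\in\Sigma(\mathcal A): d(y,\mathcal A)=d\}$. Take $Y=H(\mathbb R^2)$, the space of nonempty compact subsets of the Euclidean plane with the Hausdorff distance; the elements of $\Sigma(\mathcal A)$ are then called Steiner compacts. Minimal and maximal elements of $\Sigma_d(\mathcal A)$ are taken with respect to inclusion. Put $K_d(\mathcal A)=\bigcap_i\{x\in\mathbb R^2: \operatorname{dist}(x,A_i)\le d_i\}$. Let $a_1,a_2,a_3$ be the vertices of a regular triangle inscribed in the unit circle centred at the origin $o$, numbered counterclockwise; let $b_i$ be obtained from $a_i$ by the counterclockwise rotation about $o$ through $\pi/3$, and let $A_i=\{a_i,b_i\}$, $\mathcal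 A=(A_1,A_2,A_3)$. Put $$t_0=\frac{\sqrt5}{4}-\frac12\sqrt{\sqrt5-\frac74},\qquad \omega_0=\sqrt{1+t_0^2-t_0}.$$ \textbf{Theorem.} The circles of radius $\omega_0$ centred at $a_1$ and $a_2$ have a unique common point $k_a$ closest to $o$, and the circles of radius $\omega_0$ centred at $b_1$ and $b_2$ have a unique common point $k_b$ closest to $o$; moreover $k_a\in[o,b_1]$, $k_b\in[o,a_2]$ and $|ok_a|=|ok_b|=t_0$. Let $K_0=\{k_a,k_b\}$ and $d=\bigl(\omega_0,\omega_0,\sqrt{1+t_0^2+t_0}\bigr)$. Then: 1. $K_0\in\Sigma_d(\mathcal A)$, i.e. $K_0$ is a Steiner compact whose distances to $A_1,A_2,A_3$ are $\omega_0,\omega_0,\sqrt{1+t_0^2+t_0}$; in particular $$S_{\mathcal A}(K_0)=2\omega_0+\sqrt{1+t_0^2+t_0}=\sqrt{\frac{35}{8}+\frac38\sqrt{-47+80\sqrt5}}<3,$$ and this number is $2.94645$ rounded to five decimals, i.e. $|S_{\mathcal A}(K_0)-2.94645|<5\cdot10^{-6}$. 2. $K_0$ is the unique minimal Steiner compact in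 $\Sigma_d(\mathcal A)$. 3. $\Sigma_d(\mathcal A)$ has a unique maximal Steiner compact, and it is equal to $K_d(\mathcal A)$. 4. $\Omega(\mathcal A)$ consists of exactly three vectors, namely the cyclic permutations $(d_1,d_2,d_3)$, $(d_3,d_1,d_2)$, $(d_2,d_3,d_1)$ of $d$, so that $\Sigma(\mathcal A)$ is partitioned into the three corresponding classes; the classes $\Sigma_{(d_3,d_1,d_2)}(\mathcal A)$ and $\Sigma_{(d_2,d_3,d_1)}(\mathcal A)$ are the images of $\Sigma_d(\mathcal A)$ under the rotations of the plane about $o$ through $2\pi/3$ and $4\pi/3$, respectively. -/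

import Mathlib

open TopologicalSpace

noncomputable section

namespace FermatSteiner

/-! ### The Fermat-Steiner problem in a metric space -/

section General

variable {Y : Type*} [MetricSpace Y] {n : ℕ}

/-- The sum `S_𝒜(y)` of the distances from `y` to the points of the boundary `𝒜`. -/
def steinerSum (𝒜 : Fin n → Y) (y : Y) : ℝ := ∑ i, dist y (𝒜 i)

/-- The set `Σ(𝒜)` of all solutions: the points at which `S_𝒜` attains its least value. -/
def solutions (𝒜 : Fin n → Y) : Set Y := {y | ∀ z, steinerSum 𝒜 y ≤ steinerSum 𝒜 z}

/-- The vector `d(y, 𝒜)` of the distances from `y` to the points of `𝒜`. -/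
def distVec (𝒜 : Fin n → Y) (y : Y) : Fin n → ℝ := fun i => dist y (𝒜 i)

/-- The set `Ω(𝒜)` of the distance vectors of all solutions. -/
def distVecs (𝒜 : Fin n → Y) : Set (Fin n → ℝ) := distVec 𝒜 '' solutions 𝒜

/-- The class `Σ_d(𝒜)` of all solutions with distance vector `d`. -/
def solutionClass (𝒜 : Fin n → Y) (d : Fin n → ℝ) : Set Y :=
  {y | y ∈ solutions 𝒜 ∧ distVec 𝒜 y = d}

end General

/-- The set `K_d(𝒜)`: the intersection of the closed neighbourhoods of radii `d i` of the
compact sets `𝒜 i`. -/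
def maximalSet {X : Type*} [MetricSpace X] {n : ℕ} (𝒜 : Fin n → NonemptyCompacts X)
    (d : Fin n → ℝ) : Set X :=
  ⋂ i, {x | Metric.infDist x (𝒜 i : Set X) ≤ d i}

/-! ### The plane -/

/-- The Euclidean plane. -/
abbrev Plane : Type := EuclideanSpace ℝ (Fin 2)

/-- The (counterclockwise) rotation of the plane through the angle `θ` about the origin. -/
def rot (θ : ℝ) (x : Plane) : Plane :=
  !₂[Real.cos θ * x 0 - Real.sin θ * x 1, Real.sin θ * x 0 + Real.cos θ * x 1]

theorem continuous_rot (θ : ℝ) : Continuous (rot θ) := by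
  unfold rot
  fun_prop

/-- The image of a nonempty compact set under the rotation through `θ` about the origin. -/
def rotCompact (θ : ℝ) (K : NonemptyCompacts Plane) : NonemptyCompacts Plane :=
  K.map (rot θ) (continuous_rot θ)

/-- The compact set `{p, q}`. -/
def pair (p q : Plane) : NonemptyCompacts Plane where
  carrier := {p, q}
  isCompact' := (Set.toFinite {p, q}).isCompact
  nonempty' := ⟨p, Set.mem_insert p {q}⟩

/-- `k` is a closest point to the origin in the intersection of the circles of radius `ω`
centred at `p` and `q`. -/
def IsClosestIntersection (ω : ℝ) (p q k : Plane) : Prop :=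
  k ∈ Metric.sphere p ω ∩ Metric.sphere q ω ∧
    ∀ k' ∈ Metric.sphere p ω ∩ Metric.sphere q ω, dist 0 k ≤ dist 0 k'

/-- The parameter `t₀`. -/
def t₀ : ℝ := √5 / 4 - 1 / 2 * √(√5 - 7 / 4)

/-- The radius `ω₀`. -/
def ω₀ : ℝ := √(1 + t₀ ^ 2 - t₀)

/-- The third distance. -/
def ρ₀ : ℝ := √(1 + t₀ ^ 2 + t₀)

end FermatSteiner

end

open FermatSteiner

namespace FermatSteiner

/-! ### The constants -/

/-! The six boundary points are the vertices of a regular hexagon. If `K` has distances `r₀, r₁,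
r₂`, every point of `K` lies within `r i` of one vertex from each pair, and every vertex is served
by some point of `K`. When the total is below 3, few selections of vertices can be served by a
single point, and covering all six vertices forces two points of `K` serving complementary
selections (`IsHexPair.classify`). For such a pair, `weighted_le` bounds a weighted sum of three
distances at each point. The two sets of weights are complementary, so adding the bounds gives every
radius the same coefficient and yields `2 * ω₀ + ρ₀`, with equality only at the two points of `K₀`.
The three complementary pairs give the three classes, permuted by rotation. Any compact set between
`K₀` and `K_d` keeps the distances `d`, so these are the extreme elements. -/

theorem t₀_eq : t₀ ^ 2 - √5 / 2 * t₀ + 3 / 4 - √5 / 4 = 0 := by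
  have h5 : √5 ^ 2 = 5 := Real.sq_sqrt (by norm_num)
  have h2 : 7 / 4 ≤ √5 := Real.le_sqrt_of_sq_le (by norm_num)
  have hm : √(√5 - 7 / 4) ^ 2 = √5 - 7 / 4 := Real.sq_sqrt (by linarith)
  unfold t₀
  nlinarith

theorem sqrt_five_mul_t₀ : √5 * (2 * t₀ + 1) = 4 * t₀ ^ 2 + 3 := by
  linarith [t₀_eq]

theorem t₀_bounds : 0.21 < t₀ ∧ t₀ < 0.211 := by
  have h1 : 2.236 < √5 := Real.lt_sqrt_of_sq_lt (by norm_num)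
  have h2 : √5 < 2.2361 := by rw [Real.sqrt_lt' (by norm_num)]; norm_num
  have h3 : 0.697 < √(√5 - 7 / 4) := Real.lt_sqrt_of_sq_lt (by norm_num at *; linarith)
  have h4 : √(√5 - 7 / 4) < 0.6973 := by
    rw [Real.sqrt_lt' (by norm_num)]; norm_num at *; linarith
  unfold t₀
  constructor <;> norm_num at * <;> linarith

/-- Squaring eliminates `√5`; later identities in `t₀` then become polynomial multiples of this
rational relation. -/
theorem t₀_quartic : 4 * t₀ ^ 4 + t₀ ^ 2 - 5 * t₀ + 1 = 0 := by
  have h5 : √5 ^ 2 = 5 := Real.sq_sqrt (by norm_num)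
  have h := sqrt_five_mul_t₀
  have : (√5 * (2 * t₀ + 1)) ^ 2 = (4 * t₀ ^ 2 + 3) ^ 2 := by rw [h]
  rw [mul_pow, h5] at this
  linarith

theorem t₀_pos : 0 < t₀ := lt_trans (by norm_num) t₀_bounds.1

theorem t₀_lt_half : t₀ < 1 / 2 := lt_trans t₀_bounds.2 (by norm_num)

theorem ω₀_sq : ω₀ ^ 2 = 1 + t₀ ^ 2 - t₀ :=
  Real.sq_sqrt (by nlinarith [t₀_lt_half, t₀_pos])

theorem ρ₀_sq : ρ₀ ^ 2 = 1 + t₀ ^ 2 + t₀ :=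
  Real.sq_sqrt (by nlinarith [t₀_pos])

theorem ω₀_pos : 0 < ω₀ := Real.sqrt_pos.2 (by nlinarith [t₀_lt_half, t₀_pos])

theorem ρ₀_pos : 0 < ρ₀ := Real.sqrt_pos.2 (by nlinarith [t₀_pos])

theorem ω₀_lt_ρ₀ : ω₀ < ρ₀ :=
  Real.sqrt_lt_sqrt (by nlinarith [t₀_lt_half, t₀_pos]) (by linarith [t₀_pos])

/-- The stationarity of the total distance at `t₀`. -/
theorem ρ₀_mul_eq : 2 * (1 - 2 * t₀) * ρ₀ = (1 + 2 * t₀) * ω₀ := by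
  have h1 := t₀_pos
  have h2 := t₀_lt_half
  refine (pow_left_inj₀ (mul_nonneg (by linarith) ρ₀_pos.le)
    (mul_nonneg (by linarith) ω₀_pos.le) two_ne_zero).1 ?_
  rw [mul_pow, mul_pow, mul_pow, ρ₀_sq, ω₀_sq]
  linear_combination 3 * t₀_quartic

theorem total_sq : (2 * ω₀ + ρ₀) ^ 2 = 10 - 6 * t₀ - 6 * t₀ ^ 3 := by
  -- Multiplying by `1 - 2 * t₀` lets stationarity turn the mixed term `ω₀ * ρ₀` into a multiple of
  -- `ω₀ ^ 2`.
  have h : 1 - 2 * t₀ ≠ 0 := by linarith [t₀_lt_half]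
  refine mul_right_cancel₀ h ?_
  linear_combination 2 * ω₀ * ρ₀_mul_eq + (6 - 4 * t₀) * ω₀_sq + (1 - 2 * t₀) * ρ₀_sq
    - 3 * t₀_quartic

theorem total_eq : 2 * ω₀ + ρ₀ = √(35 / 8 + 3 / 8 * √(-47 + 80 * √5)) := by
  have h1 := t₀_pos
  have h2 := t₀_lt_half
  have h3 : t₀ ^ 3 < 1 / 8 := by
    have := pow_lt_pow_left₀ h2 h1.le three_ne_zero
    norm_num at this ⊢; exact this
  have h : √(-47 + 80 * √5) = 15 - 16 * t₀ - 16 * t₀ ^ 3 := by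
    rw [Real.sqrt_eq_iff_eq_sq _ (by linarith)]
    -- The factor `2 * t₀ + 1` makes `√5` polynomial in `t₀`; the difference of the two sides is
    -- then divisible by the quartic.
    · refine mul_right_cancel₀ (b := 2 * t₀ + 1) (by linarith) ?_
      linear_combination 80 * sqrt_five_mul_t₀ -
        (32 + 224 * t₀ + 64 * t₀ ^ 2 + 128 * t₀ ^ 3) * t₀_quartic
    · have : 1 ≤ √5 := Real.one_le_sqrt.2 (by norm_num)
      linarith
  rw [h, eq_comm, show 35 / 8 + 3 / 8 * (15 - 16 * t₀ - 16 * t₀ ^ 3) = (2 * ω₀ + ρ₀) ^ 2 by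
    rw [total_sq]; ring]
  exact Real.sqrt_sq (by linarith [ω₀_pos, ρ₀_pos])

theorem abs_total_sub_lt : |2 * ω₀ + ρ₀ - 2.94645| < 0.000005 := by
  have h1 : 2.23606797 < √5 := Real.lt_sqrt_of_sq_lt (by norm_num)
  have h2 : √5 < 2.23606798 := by rw [Real.sqrt_lt' (by norm_num)]; norm_num
  have h3 : 11.48413 < √(-47 + 80 * √5) := Real.lt_sqrt_of_sq_lt (by norm_num at *; linarith)
  have h4 : √(-47 + 80 * √5) < 11.48414 := by
    rw [Real.sqrt_lt' (by norm_num)]; norm_num at *; linarith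
  rw [total_eq, abs_lt, lt_sub_iff_add_lt, sub_lt_iff_lt_add]
  constructor
  · refine Real.lt_sqrt_of_sq_lt ?_
    norm_num at *; linarith
  · rw [Real.sqrt_lt' (by norm_num)]
    norm_num at *; linarith

theorem total_lt_three : 2 * ω₀ + ρ₀ < 3 := by
  have := (abs_lt.1 abs_total_sub_lt).2
  norm_num at *; linarith

/-! ### Distances to the vertices of a regular hexagon -/

section InnerProduct

variable {E : Type*} [NormedAddCommGroup E] [InnerProductSpace ℝ E]

local notation "⟪" x ", " y "⟫" => inner ℝ x y

/-- Two unit vectors which span a regular triangle with the origin. -/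
structure IsHexPair (u v : E) : Prop where
  norm_left : ‖u‖ = 1
  norm_right : ‖v‖ = 1
  inner_eq : ⟪u, v⟫ = 1 / 2

namespace IsHexPair

variable {u v x : E}

theorem inner_left_self (h : IsHexPair u v) : ⟪u, u⟫ = 1 := by simp [h.norm_left]

theorem inner_right_self (h : IsHexPair u v) : ⟪v, v⟫ = 1 := by simp [h.norm_right]

theorem inner_comm (h : IsHexPair u v) : ⟪v, u⟫ = 1 / 2 := by rw [real_inner_comm, h.inner_eq]

theorem norm_sq (h : IsHexPair u v) (p q : ℝ) : ‖p • u + q • v‖ ^ 2 = p ^ 2 + p * q + q ^ 2 := by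
  rw [← real_inner_self_eq_norm_sq]
  simp only [inner_add_left, inner_add_right, real_inner_smul_left, real_inner_smul_right,
    h.inner_left_self, h.inner_right_self, h.inner_eq, h.inner_comm]
  ring

theorem norm_eq (h : IsHexPair u v) {w : E} {c : ℝ} (p q : ℝ) (hw : w = p • u + q • v) (hc : 0 ≤ c)
    (hpq : p ^ 2 + p * q + q ^ 2 = c ^ 2) : ‖w‖ = c := by
  rw [hw, ← pow_left_inj₀ (norm_nonneg _) hc two_ne_zero, h.norm_sq, hpq]

theorem rotate (h : IsHexPair u v) : IsHexPair (v - u) (-u) where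
  norm_left := h.norm_eq (-1) 1 (by module) zero_le_one (by norm_num)
  norm_right := by rw [norm_neg, h.norm_left]
  inner_eq := by
    rw [inner_neg_right, inner_sub_left, h.inner_comm, h.inner_left_self]; norm_num

/-- Reflection in the line orthogonal to `u`. It swaps the first two boundary pairs, the two points
of the third, and the two points of `K₀`. -/
theorem reflect (h : IsHexPair u v) : IsHexPair (-u) (v - u) where
  norm_left := by rw [norm_neg, h.norm_left]
  norm_right := h.rotate.norm_left
  inner_eq := by rw [real_inner_comm]; exact h.rotate.inner_eq

theorem rotate_rotate (h : IsHexPair u v) : IsHexPair (-v) (u - v) := by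
  have := h.rotate.rotate
  rwa [show -u - (v - u) = -v by abel, neg_sub] at this

theorem swap (h : IsHexPair u v) : IsHexPair v u where
  norm_left := h.norm_right
  norm_right := h.norm_left
  inner_eq := h.inner_comm

theorem dist_left (h : IsHexPair u v) : dist (t₀ • v) u = ω₀ := by
  rw [dist_eq_norm]
  exact h.norm_eq (-1) t₀ (by module) ω₀_pos.le (by rw [ω₀_sq]; ring)

theorem dist_sub (h : IsHexPair u v) : dist (t₀ • v) (v - u) = ω₀ := by
  rw [dist_eq_norm]
  exact h.norm_eq 1 (t₀ - 1) (by module) ω₀_pos.le (by rw [ω₀_sq]; ring)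

theorem dist_sub' (h : IsHexPair u v) : dist (t₀ • v) (u - v) = ρ₀ := by
  rw [dist_eq_norm]
  exact h.norm_eq (-1) (t₀ + 1) (by module) ρ₀_pos.le (by rw [ρ₀_sq]; ring)

theorem dist_right (h : IsHexPair u v) : dist (t₀ • v) v ≤ ω₀ := by
  have h1 := t₀_pos
  have h2 := t₀_lt_half
  rw [dist_eq_norm, h.norm_eq (c := 1 - t₀) 0 (t₀ - 1) (by module) (by linarith) (by ring)]
  exact Real.le_sqrt_of_sq_le (by nlinarith)

/-- The weighted sum of distances to three vertices of a hexagon is least at `t₀ • v`. -/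
theorem weighted_le (h : IsHexPair u v) (x : E) :
    2 * t₀ * ω₀ + ω₀ + (1 + 2 * t₀) / 2 * ρ₀ ≤
      2 * t₀ * dist x u + dist x (v - u) + (1 + 2 * t₀) / 2 * dist x (u - v) ∧
    (2 * t₀ * dist x u + dist x (v - u) + (1 + 2 * t₀) / 2 * dist x (u - v) =
      2 * t₀ * ω₀ + ω₀ + (1 + 2 * t₀) / 2 * ρ₀ → x = t₀ • v) := by
  have ht := t₀_pos
  have ht' := t₀_lt_half
  have hω := ω₀_pos
  have hρ := ρ₀_pos
  have n1 : ‖t₀ • v - u‖ = ω₀ := by rw [← dist_eq_norm, h.dist_left]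
  have n2 : ‖t₀ • v - (v - u)‖ = ω₀ := by rw [← dist_eq_norm, h.dist_sub]
  have n3 : ‖t₀ • v - (u - v)‖ = ρ₀ := by rw [← dist_eq_norm, h.dist_sub']
  have c1 : ⟪t₀ • v - u, x - u⟫ ≤ ω₀ * dist x u := by
    rw [dist_eq_norm, ← n1]; exact real_inner_le_norm _ _
  have c2 : ⟪t₀ • v - (v - u), x - (v - u)⟫ ≤ ω₀ * dist x (v - u) := by
    rw [dist_eq_norm, ← n2]; exact real_inner_le_norm _ _
  have c3 : ⟪t₀ • v - (u - v), x - (u - v)⟫ ≤ ρ₀ * dist x (u - v) := by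
    rw [dist_eq_norm, ← n3]; exact real_inner_le_norm _ _
  -- The terms in `x` cancel: this is the vanishing of the weighted sum of unit vectors at `t₀ • v`,
  -- with the third weight rescaled through `ρ₀_mul_eq`.
  have key : 2 * t₀ * ⟪t₀ • v - u, x - u⟫ + ⟪t₀ • v - (v - u), x - (v - u)⟫ +
      (1 - 2 * t₀) * ⟪t₀ • v - (u - v), x - (u - v)⟫ =
      2 * t₀ * ω₀ ^ 2 + ω₀ ^ 2 + (1 - 2 * t₀) * ρ₀ ^ 2 := by
    rw [ω₀_sq, ρ₀_sq]
    simp only [inner_sub_left, inner_sub_right, real_inner_smul_left,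
      h.inner_left_self, h.inner_right_self, h.inner_eq, h.inner_comm]
    ring
  have e : (1 + 2 * t₀) / 2 * ω₀ = (1 - 2 * t₀) * ρ₀ := by linarith [ρ₀_mul_eq]
  have c3' := mul_le_mul_of_nonneg_left c3 (by linarith : (0 : ℝ) ≤ 1 - 2 * t₀)
  have c1' := mul_le_mul_of_nonneg_left c1 (by linarith : (0 : ℝ) ≤ 2 * t₀)
  have k1 : ω₀ * (2 * t₀ * ω₀ + ω₀ + (1 + 2 * t₀) / 2 * ρ₀) =
      2 * t₀ * ω₀ ^ 2 + ω₀ ^ 2 + (1 - 2 * t₀) * ρ₀ ^ 2 := by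
    linear_combination ρ₀ * e
  have k2 : ω₀ * (2 * t₀ * dist x u + dist x (v - u) + (1 + 2 * t₀) / 2 * dist x (u - v)) =
      2 * t₀ * (ω₀ * dist x u) + ω₀ * dist x (v - u) +
        (1 - 2 * t₀) * (ρ₀ * dist x (u - v)) := by
    linear_combination dist x (u - v) * e
  refine ⟨le_of_mul_le_mul_left (by linarith) hω, fun heq => ?_⟩
  rw [heq, k1] at k2
  have d2 : ⟪t₀ • v - (v - u), x - (v - u)⟫ = ω₀ * dist x (v - u) := by linarith
  have d1 : ⟪t₀ • v - u, x - u⟫ = ω₀ * dist x u :=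
    mul_left_cancel₀ (by linarith : (2 * t₀) ≠ 0) (by linarith)
  rw [dist_eq_norm, ← n1, inner_eq_norm_mul_iff_real, n1] at d1
  rw [dist_eq_norm, ← n2, inner_eq_norm_mul_iff_real, n2] at d2
  set p := ‖x - u‖
  set q := ‖x - (v - u)‖
  -- Equality in Cauchy–Schwarz puts `x` on the rays from `u` and from `v - u` through `t₀ • v`.
  -- Eliminating `x` leaves a relation between independent vectors, which forces `p = ω₀` since `t₀
  -- ≠ 1 / 2`.
  have d : (p + q - 2 * ω₀) • u + (ω₀ - t₀ * p + (t₀ - 1) * q) • v = 0 := by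
    rw [← sub_eq_zero] at d1 d2
    rw [← sub_self (0 : E)]
    nth_rewrite 1 [← d2]
    rw [← d1]
    module
  have i1 := congrArg (⟪u, ·⟫) d
  have i2 := congrArg (⟪v, ·⟫) d
  simp only [inner_add_right, real_inner_smul_right, h.inner_left_self, h.inner_right_self,
    h.inner_eq, h.inner_comm, inner_zero_right] at i1 i2
  have hp : p = ω₀ := by
    refine mul_left_cancel₀ (by linarith : 1 - 2 * t₀ ≠ 0) ?_
    linear_combination 4 / 3 * (i2 - i1 / 2) - (t₀ - 1) * (4 / 3) * (i1 - i2 / 2)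
  rw [hp] at d1
  have := smul_right_injective E hω.ne' d1
  simpa using this.symm

end IsHexPair

/-! ### Serving all six vertices: the lower bound and its equality cases -/

/-- The set `K` is at Hausdorff distance at most `r` from `{p, q}`. -/
structure NearPair (p q : E) (r : ℝ) (K : Set E) : Prop where
  mem : ∀ x ∈ K, dist x p ≤ r ∨ dist x q ≤ r
  left : ∃ x ∈ K, dist x p ≤ r
  right : ∃ x ∈ K, dist x q ≤ r

theorem two_le_dist_add {p : E} (hp : ‖p‖ = 1) (x : E) : 2 ≤ dist x p + dist x (-p) := by
  have : dist p (-p) = 2 := by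
    rw [dist_eq_norm, sub_neg_eq_add, ← two_smul ℝ p, norm_smul, hp]; norm_num
  rw [← this, dist_comm x p]
  exact dist_triangle _ _ _

theorem neg_sub_sub {G : Type*} [AddCommGroup G] (u v : G) : -u - (v - u) = -v := by abel

namespace IsHexPair

variable {u v x y : E}

/-- The lower bound for the radii served by two points with opposite nearest vertices. -/
theorem total_le_of_dist_le (h : IsHexPair u v) {r₁ r₂ r₃ : ℝ}
    (hx₁ : dist x u ≤ r₁) (hx₂ : dist x (v - u) ≤ r₂) (hx₃ : dist x (u - v) ≤ r₃)
    (hy₁ : dist y v ≤ r₁) (hy₂ : dist y (-u) ≤ r₂) (hy₃ : dist y (-v) ≤ r₃) :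
    2 * ω₀ + ρ₀ ≤ r₁ + r₂ + r₃ ∧
      (r₁ + r₂ + r₃ = 2 * ω₀ + ρ₀ →
        (r₁ = ω₀ ∧ r₂ = ω₀ ∧ r₃ = ρ₀) ∧ x = t₀ • v ∧ y = t₀ • (v - u)) := by
  have ht := t₀_pos
  obtain ⟨lx, ex⟩ := h.weighted_le x
  -- Reflection interchanges the weights `2 * t₀` and `1` of the first two radii, so in the sum all
  -- three radii have coefficient `1 + 2 * t₀`.
  obtain ⟨ly, ey⟩ := h.reflect.weighted_le y
  rw [show v - u - -u = v by abel, show -u - (v - u) = -v by abel] at ly ey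
  have m1 := mul_le_mul_of_nonneg_left hx₁ (by linarith : (0 : ℝ) ≤ 2 * t₀)
  have m2 := mul_le_mul_of_nonneg_left hx₃ (by linarith : (0 : ℝ) ≤ (1 + 2 * t₀) / 2)
  have m3 := mul_le_mul_of_nonneg_left hy₂ (by linarith : (0 : ℝ) ≤ 2 * t₀)
  have m4 := mul_le_mul_of_nonneg_left hy₃ (by linarith : (0 : ℝ) ≤ (1 + 2 * t₀) / 2)
  refine ⟨le_of_mul_le_mul_left (by linarith) (by linarith : (0 : ℝ) < 1 + 2 * t₀),
    fun heq => ?_⟩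
  have hm : (1 + 2 * t₀) * (r₁ + r₂ + r₃) = (1 + 2 * t₀) * (2 * ω₀ + ρ₀) := by rw [heq]
  have hx := ex (by linarith)
  have hy := ey (by linarith)
  rw [hx, h.dist_left] at hx₁
  rw [hx, h.dist_sub] at hx₂
  rw [hx, h.dist_sub'] at hx₃
  exact ⟨⟨by linarith, by linarith, by linarith⟩, hx, hy⟩

/-- The unit vectors `u`, `v - u`, `-v` sum to zero, so the linear bounds `1 - ⟪p, x⟫ ≤ dist x p`
add up to 3. -/
theorem three_le_dist_add (h : IsHexPair u v) (x : E) :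
    3 ≤ dist x u + dist x (v - u) + dist x (-v) := by
  have key {p : E} (hp : ‖p‖ = 1) : 1 - ⟪p, x⟫ ≤ dist x p := by
    have := real_inner_le_norm p (p - x)
    rwa [inner_sub_right, real_inner_self_eq_norm_sq, hp, one_pow, one_mul, ← dist_eq_norm,
      dist_comm] at this
  have h1 := key h.norm_left
  have h2 := key h.rotate.norm_left
  have h3 := key ((norm_neg v).trans h.norm_right)
  rw [inner_sub_left] at h2
  rw [inner_neg_left] at h3
  linarith

/-- Each complementary pair of selections yields one distance vector. The points of `K` are recorded
only for the first, because rotation handles the other two classes. -/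
theorem classify {r₀ r₁ r₂ : ℝ} {K : Set E} (h : IsHexPair u v) (h₀ : NearPair u v r₀ K)
    (h₁ : NearPair (v - u) (-u) r₁ K) (h₂ : NearPair (-v) (u - v) r₂ K) :
    2 * ω₀ + ρ₀ ≤ r₀ + r₁ + r₂ ∧
      (r₀ + r₁ + r₂ = 2 * ω₀ + ρ₀ →
        ((r₀ = ω₀ ∧ r₁ = ω₀ ∧ r₂ = ρ₀) ∧ t₀ • v ∈ K ∧ t₀ • (v - u) ∈ K) ∨
        (r₀ = ρ₀ ∧ r₁ = ω₀ ∧ r₂ = ω₀) ∨ (r₀ = ω₀ ∧ r₁ = ρ₀ ∧ r₂ = ω₀)) := by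
  have h3 := total_lt_three
  rcases le_or_gt 3 (r₀ + r₁ + r₂) with hr | hr
  · exact ⟨by linarith, fun _ => by linarith⟩
  let T (p q s : E) : Prop := ∃ x ∈ K, dist x p ≤ r₀ ∧ dist x q ≤ r₁ ∧ dist x s ≤ r₂
  have hmem {x : E} (hx : x ∈ K) :=
    And.intro (h₀.mem x hx) (And.intro (h₁.mem x hx) (h₂.mem x hx))
  have e1 : T u (v - u) (-v) → False := by
    rintro ⟨x, -, k0, k1, k2⟩
    linarith [h.three_le_dist_add x]
  have e2 : T v (-u) (u - v) → False := by
    rintro ⟨x, -, k0, k1, k2⟩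
    linarith [h.swap.three_le_dist_add x]
  -- Each of these selections contains one antipodal pair, so two of the radii sum to at least 2.
  -- All three selections together would give a total of at least 3.
  have e3 : ¬(T u (v - u) (u - v) ∧ T u (-u) (-v) ∧ T v (v - u) (-v)) := by
    rintro ⟨⟨x, -, -, x1, x2⟩, ⟨y, -, y0, y1, -⟩, ⟨z, -, z0, -, z2⟩⟩
    have := two_le_dist_add h.rotate.norm_left x
    rw [neg_sub] at this
    linarith [two_le_dist_add h.norm_left y, two_le_dist_add h.norm_right z]
  have e4 : ¬(T v (-u) (-v) ∧ T v (v - u) (u - v) ∧ T u (-u) (u - v)) := by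
    rintro ⟨⟨x, -, x0, -, x2⟩, ⟨y, -, -, y1, y2⟩, ⟨z, -, z0, z1, -⟩⟩
    have := two_le_dist_add h.rotate.norm_left y
    rw [neg_sub] at this
    linarith [two_le_dist_add h.norm_right x, two_le_dist_add h.norm_left z]
  have cover : (T u (v - u) (u - v) ∧ T v (-u) (-v)) ∨ (T v (v - u) (-v) ∧ T u (-u) (u - v)) ∨
      (T u (-u) (-v) ∧ T v (v - u) (u - v)) := by
    have u₀ : T u (v - u) (-v) ∨ T u (v - u) (u - v) ∨ T u (-u) (-v) ∨ T u (-u) (u - v) := by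
      obtain ⟨x, hx, k⟩ := h₀.left
      rcases hmem hx with ⟨-, k1 | k1, k2 | k2⟩ <;> simp only [T] <;> grind
    have v₀ : T v (v - u) (-v) ∨ T v (v - u) (u - v) ∨ T v (-u) (-v) ∨ T v (-u) (u - v) := by
      obtain ⟨x, hx, k⟩ := h₀.right
      rcases hmem hx with ⟨-, k1 | k1, k2 | k2⟩ <;> simp only [T] <;> grind
    have u₁ : T u (v - u) (-v) ∨ T u (v - u) (u - v) ∨ T v (v - u) (-v) ∨ T v (v - u) (u - v) := by
      obtain ⟨x, hx, k⟩ := h₁.left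
      rcases hmem hx with ⟨k1 | k1, -, k2 | k2⟩ <;> simp only [T] <;> grind
    have v₁ : T u (-u) (-v) ∨ T u (-u) (u - v) ∨ T v (-u) (-v) ∨ T v (-u) (u - v) := by
      obtain ⟨x, hx, k⟩ := h₁.right
      rcases hmem hx with ⟨k1 | k1, -, k2 | k2⟩ <;> simp only [T] <;> grind
    have u₂ : T u (v - u) (-v) ∨ T u (-u) (-v) ∨ T v (v - u) (-v) ∨ T v (-u) (-v) := by
      obtain ⟨x, hx, k⟩ := h₂.left
      rcases hmem hx with ⟨k1 | k1, k2 | k2, -⟩ <;> simp only [T] <;> grind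
    have v₂ : T u (v - u) (u - v) ∨ T u (-u) (u - v) ∨ T v (v - u) (u - v) ∨ T v (-u) (u - v) := by
      obtain ⟨x, hx, k⟩ := h₂.right
      rcases hmem hx with ⟨k1 | k1, k2 | k2, -⟩ <;> simp only [T] <;> grind
    -- What remains is purely propositional: the six covering conditions and `e1`–`e4` leave only
    -- complementary pairs.
    clear_value T
    grind
  rcases cover with ⟨⟨x, hx, x0, x1, x2⟩, ⟨y, hy, y0, y1, y2⟩⟩ |
    ⟨⟨x, hx, x0, x1, x2⟩, ⟨y, hy, y0, y1, y2⟩⟩ | ⟨⟨x, hx, x0, x1, x2⟩, ⟨y, hy, y0, y1, y2⟩⟩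
  · obtain ⟨l, e⟩ := h.total_le_of_dist_le x0 x1 x2 y0 y1 y2
    refine ⟨l, fun heq => Or.inl ?_⟩
    obtain ⟨hr, rfl, rfl⟩ := e heq
    exact ⟨hr, hx, hy⟩
  · obtain ⟨l, e⟩ := h.rotate.total_le_of_dist_le (x := x) (y := y) x1 (neg_sub_sub u v ▸ x2)
      (by simpa using x0) y1 (by simpa using y2) (by simpa using y0)
    refine ⟨by linarith, fun heq => Or.inr (Or.inl ?_)⟩
    obtain ⟨⟨k1, k2, k0⟩, -⟩ := e (by linarith)
    exact ⟨k0, k1, k2⟩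
  · obtain ⟨l, e⟩ := h.rotate_rotate.total_le_of_dist_le (x := x) (y := y) x2 (by simpa using x0)
      (neg_sub_sub v u ▸ x1) y2 (by simpa using y0) (by simpa using y1)
    refine ⟨by linarith, fun heq => Or.inr (Or.inr ?_)⟩
    obtain ⟨⟨k2, k0, k1⟩, -⟩ := e (by linarith)
    exact ⟨k0, k1, k2⟩

/-! ### Compact sets containing `K₀`, and the points of `K₀` on the circles -/

theorem nearPair_left (h : IsHexPair u v) {K : Set E} (hK : {t₀ • v, t₀ • (v - u)} ⊆ K)
    (hK' : ∀ x ∈ K, dist x u ≤ ω₀ ∨ dist x v ≤ ω₀) : NearPair u v ω₀ K where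
  mem := hK'
  left := ⟨_, hK (Or.inl rfl), h.dist_left.le⟩
  right := ⟨_, hK (Or.inl rfl), h.dist_right⟩

theorem nearPair_middle (h : IsHexPair u v) {K : Set E} (hK : {t₀ • v, t₀ • (v - u)} ⊆ K)
    (hK' : ∀ x ∈ K, dist x (v - u) ≤ ω₀ ∨ dist x (-u) ≤ ω₀) : NearPair (v - u) (-u) ω₀ K where
  mem := hK'
  left := ⟨_, hK (Or.inl rfl), h.dist_sub.le⟩
  right := ⟨_, hK (Or.inr rfl), h.reflect.dist_left.le⟩

theorem nearPair_right (h : IsHexPair u v) {K : Set E} (hK : {t₀ • v, t₀ • (v - u)} ⊆ K)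
    (hK' : ∀ x ∈ K, dist x (-v) ≤ ρ₀ ∨ dist x (u - v) ≤ ρ₀) : NearPair (-v) (u - v) ρ₀ K where
  mem := hK'
  left := ⟨_, hK (Or.inr rfl),
    (congrArg (dist _) (neg_sub_sub u v)).symm.trans_le h.reflect.dist_sub'.le⟩
  right := ⟨_, hK (Or.inl rfl), h.dist_sub'.le⟩

theorem nearPair_pair (h : IsHexPair u v) :
    NearPair u v ω₀ {t₀ • v, t₀ • (v - u)} ∧ NearPair (v - u) (-u) ω₀ {t₀ • v, t₀ • (v - u)} ∧
      NearPair (-v) (u - v) ρ₀ {t₀ • v, t₀ • (v - u)} := by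
  refine ⟨h.nearPair_left subset_rfl ?_, h.nearPair_middle subset_rfl ?_,
    h.nearPair_right subset_rfl ?_⟩ <;> rintro x (rfl | rfl)
  · exact Or.inl h.dist_left.le
  · exact Or.inr (by simpa using h.reflect.dist_sub.le)
  · exact Or.inl h.dist_sub.le
  · exact Or.inl h.reflect.dist_right
  · exact Or.inr h.dist_sub'.le
  · exact Or.inl ((congrArg (dist _) (neg_sub_sub u v)).symm.trans_le h.reflect.dist_sub'.le)

/-- Adding the circle equations determines `⟪x, v⟫`; Cauchy–Schwarz then gives `(‖x‖ - t₀) * (‖x‖ -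
(1 - t₀)) ≤ 0`, and `t₀ < 1 / 2` makes `t₀` the smaller root. -/
theorem t₀_le_norm (h : IsHexPair u v) (hu : dist x u = ω₀) (hw : dist x (v - u) = ω₀) :
    t₀ ≤ ‖x‖ ∧ (‖x‖ ≤ t₀ → x = t₀ • v) := by
  have ht := t₀_pos
  have ht' := t₀_lt_half
  rw [dist_eq_norm, ← pow_left_inj₀ (norm_nonneg _) ω₀_pos.le two_ne_zero, norm_sub_sq_real]
    at hu hw
  rw [h.norm_left, ω₀_sq] at hu
  rw [h.rotate.norm_left, ω₀_sq, inner_sub_right] at hw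
  have hv : ⟪x, v⟫ = ‖x‖ ^ 2 + t₀ - t₀ ^ 2 := by linarith
  have hle := real_inner_le_norm x v
  rw [h.norm_right, mul_one, hv] at hle
  have hn : t₀ ≤ ‖x‖ := by nlinarith
  refine ⟨hn, fun hx => ?_⟩
  have hx' := le_antisymm hx hn
  have : ⟪x, v⟫ = ‖x‖ * ‖v‖ := by rw [hv, hx', h.norm_right]; ring
  rwa [inner_eq_norm_mul_iff_real, h.norm_right, one_smul, hx'] at this

end IsHexPair

end InnerProduct

/-! ### Hausdorff distances to pairs -/

theorem coe_pair (p q : Plane) : (pair p q : Set Plane) = {p, q} := rfl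

theorem dist_pair_le_iff {p q : Plane} {r : ℝ} {K : NonemptyCompacts Plane} :
    dist K (pair p q) ≤ r ↔ NearPair p q r (K : Set Plane) := by
  have fin {K L : NonemptyCompacts Plane} : Metric.hausdorffEDist (K : Set Plane) L ≠ ⊤ :=
    Metric.hausdorffEDist_ne_top_of_nonempty_of_bounded K.nonempty L.nonempty
      K.isCompact.isBounded L.isCompact.isBounded
  constructor
  · intro h
    have near {K L : NonemptyCompacts Plane} (h : dist K L ≤ r) {x : Plane} (hx : x ∈ K) :
        ∃ y ∈ L, dist x y ≤ r := by
      obtain ⟨y, hy, e⟩ := L.isCompact.exists_infDist_eq_dist L.nonempty x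
      exact ⟨y, hy, e ▸ (Metric.infDist_le_hausdorffDist_of_mem hx fin).trans h⟩
    have h' : dist (pair p q) K ≤ r := by rwa [dist_comm]
    refine ⟨fun x hx => ?_, ?_, ?_⟩
    · obtain ⟨y, (rfl | rfl), hy⟩ := near h hx
      exacts [Or.inl hy, Or.inr hy]
    · obtain ⟨y, hy, e⟩ := near h' (Or.inl rfl : p ∈ ({p, q} : Set Plane))
      exact ⟨y, hy, by rwa [dist_comm]⟩
    · obtain ⟨y, hy, e⟩ := near h' (Or.inr rfl : q ∈ ({p, q} : Set Plane))
      exact ⟨y, hy, by rwa [dist_comm]⟩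
  · rintro ⟨h, ⟨y, hy, ey⟩, ⟨z, hz, ez⟩⟩
    refine Metric.hausdorffDist_le_of_mem_dist (dist_nonneg.trans ey) (fun x hx => ?_) ?_
    · rcases h x hx with k | k
      exacts [⟨p, Or.inl rfl, k⟩, ⟨q, Or.inr rfl, k⟩]
    · rintro x (rfl | rfl)
      exacts [⟨y, hy, by rwa [dist_comm]⟩, ⟨z, hz, by rwa [dist_comm]⟩]

theorem infDist_pair_le_iff {p q x : Plane} {r : ℝ} :
    Metric.infDist x ↑(pair p q) ≤ r ↔ dist x p ≤ r ∨ dist x q ≤ r := by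
  constructor
  · intro h
    obtain ⟨y, (rfl | rfl), e⟩ := (pair p q).isCompact.exists_infDist_eq_dist (pair p q).nonempty x
    exacts [Or.inl (e ▸ h), Or.inr (e ▸ h)]
  · have hp : p ∈ (pair p q : Set Plane) := Or.inl rfl
    have hq : q ∈ (pair p q : Set Plane) := Or.inr rfl
    rintro (h | h)
    exacts [(Metric.infDist_le_dist_of_mem hp).trans h, (Metric.infDist_le_dist_of_mem hq).trans h]

/-- At least one boundary set is needed for boundedness, hence the index type `Fin (n + 1)`. -/
theorem isCompact_maximalSet {X : Type*} [MetricSpace X] [ProperSpace X] {n : ℕ}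
    (𝒜 : Fin (n + 1) → NonemptyCompacts X) (d : Fin (n + 1) → ℝ) :
    IsCompact (maximalSet 𝒜 d) := by
  have hc : IsClosed (maximalSet 𝒜 d) :=
    isClosed_iInter fun i => isClosed_le (Metric.continuous_infDist_pt _) continuous_const
  refine Metric.isCompact_of_isClosed_isBounded hc ?_
  refine ((𝒜 0).isCompact.cthickening (r := d 0)).isBounded.subset fun x hx => ?_
  have := Set.mem_iInter.1 hx 0
  rw [Metric.mem_cthickening_iff, ← ENNReal.ofReal_toReal (Metric.infEDist_ne_top (𝒜 0).nonempty)]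
  exact ENNReal.ofReal_le_ofReal this

/-! ### Rotations -/

theorem rot_rot (θ φ : ℝ) (x : Plane) : rot θ (rot φ x) = rot (θ + φ) x := by
  ext i
  fin_cases i <;> simp [rot, Real.cos_add, Real.sin_add] <;> ring

theorem rot_pi (x : Plane) : rot Real.pi x = -x := by
  ext i
  fin_cases i <;> simp [rot]

theorem rot_two_pi (x : Plane) : rot (2 * Real.pi) x = x := by
  ext i
  fin_cases i <;> simp [rot]

theorem norm_rot (θ : ℝ) (x : Plane) : ‖rot θ x‖ = ‖x‖ := by
  rw [EuclideanSpace.norm_eq, EuclideanSpace.norm_eq]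
  simp only [rot, Fin.sum_univ_two, Real.norm_eq_abs, sq_abs]
  congr 1
  simp only [Matrix.cons_val_zero, Matrix.cons_val_one]
  linear_combination (x 0 ^ 2 + x 1 ^ 2) * Real.sin_sq_add_cos_sq θ

theorem rot_sub (θ : ℝ) (x y : Plane) : rot θ (x - y) = rot θ x - rot θ y := by
  ext i
  fin_cases i <;> simp [rot] <;> ring

theorem rot_neg (θ : ℝ) (x : Plane) : rot θ (-x) = -rot θ x := by
  rw [← rot_pi, rot_rot, add_comm, ← rot_rot, rot_pi]

theorem isometry_rot (θ : ℝ) : Isometry (rot θ) :=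
  Isometry.of_dist_eq fun x y => by rw [dist_eq_norm, ← rot_sub, norm_rot, dist_eq_norm]

theorem rot_two_pi_div_three (x : Plane) :
    rot (2 * Real.pi / 3) x = rot (Real.pi / 3) x - x := by
  have hc : Real.cos (2 * Real.pi / 3) = -(1 / 2) := by
    rw [show 2 * Real.pi / 3 = Real.pi - Real.pi / 3 by ring, Real.cos_pi_sub,
      Real.cos_pi_div_three]
  have hs : Real.sin (2 * Real.pi / 3) = Real.sin (Real.pi / 3) := by
    rw [show 2 * Real.pi / 3 = Real.pi - Real.pi / 3 by ring, Real.sin_pi_sub]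
  ext i
  fin_cases i <;> simp [rot, hc, hs] <;> ring

theorem rot_four_pi_div_three (x : Plane) :
    rot (4 * Real.pi / 3) x = -rot (Real.pi / 3) x := by
  rw [← rot_pi, rot_rot]
  congr 1
  ring

theorem rot_pi_div_three_rot (x : Plane) :
    rot (Real.pi / 3) (rot (Real.pi / 3) x) = rot (Real.pi / 3) x - x := by
  rw [rot_rot, ← rot_two_pi_div_three]
  congr 1
  ring

theorem isHexPair_rot {x : Plane} (hx : ‖x‖ = 1) : IsHexPair x (rot (Real.pi / 3) x) where
  norm_left := hx
  norm_right := by rw [norm_rot, hx]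
  inner_eq := by
    -- The rotation by `2π/3` of `x` is the difference of the two vectors; its unit norm gives their
    -- inner product.
    have h := norm_rot (2 * Real.pi / 3) x
    rw [rot_two_pi_div_three, hx, ← sq_eq_sq₀ (norm_nonneg _) zero_le_one, norm_sub_sq_real,
      norm_rot, hx, real_inner_comm] at h
    linarith

theorem dist_rotCompact (θ : ℝ) (K L : NonemptyCompacts Plane) :
    dist (rotCompact θ K) (rotCompact θ L) = dist K L := by
  simp only [Metric.NonemptyCompacts.dist_eq, rotCompact, NonemptyCompacts.coe_map]
  exact Metric.hausdorffDist_image (isometry_rot θ)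

theorem rotCompact_rotCompact (θ φ : ℝ) (K : NonemptyCompacts Plane) :
    rotCompact θ (rotCompact φ K) = rotCompact (θ + φ) K := by
  ext x
  simp [rotCompact, rot_rot]

theorem rotCompact_two_pi (K : NonemptyCompacts Plane) : rotCompact (2 * Real.pi) K = K := by
  ext x
  simp [rotCompact, rot_two_pi]

theorem rotCompact_pair (θ : ℝ) (p q : Plane) :
    rotCompact θ (pair p q) = pair (rot θ p) (rot θ q) := by
  apply NonemptyCompacts.ext
  simp [rotCompact, coe_pair, Set.image_pair]

/-! ### The three classes -/

/-- The boundary spanned by two consecutive vertices of a regular hexagon. -/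
structure IsHexBoundary (𝒜 : Fin 3 → NonemptyCompacts Plane) (u v : Plane) : Prop where
  isHexPair : IsHexPair u v
  rot_left : rot (2 * Real.pi / 3) u = v - u
  rot_right : rot (2 * Real.pi / 3) v = -u
  apply_zero : 𝒜 0 = pair u v
  apply_one : 𝒜 1 = pair (v - u) (-u)
  apply_two : 𝒜 2 = pair (-v) (u - v)

namespace IsHexBoundary

variable {𝒜 : Fin 3 → NonemptyCompacts Plane} {u v : Plane} {K : NonemptyCompacts Plane}

theorem classify (h : IsHexBoundary 𝒜 u v) (K : NonemptyCompacts Plane) :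
    2 * ω₀ + ρ₀ ≤ steinerSum 𝒜 K ∧ (steinerSum 𝒜 K = 2 * ω₀ + ρ₀ →
      (distVec 𝒜 K = ![ω₀, ω₀, ρ₀] ∧ pair (t₀ • v) (t₀ • (v - u)) ≤ K) ∨
      distVec 𝒜 K = ![ρ₀, ω₀, ω₀] ∨ distVec 𝒜 K = ![ω₀, ρ₀, ω₀]) := by
  have hv (p q r : ℝ) : distVec 𝒜 K = ![p, q, r] ↔
      dist K (𝒜 0) = p ∧ dist K (𝒜 1) = q ∧ dist K (𝒜 2) = r := by
    simp [funext_iff, Fin.forall_fin_succ, distVec]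
  simp only [hv, steinerSum, Fin.sum_univ_three]
  obtain ⟨l, e⟩ := h.isHexPair.classify (dist_pair_le_iff.1 (congrArg (dist K) h.apply_zero).ge)
    (dist_pair_le_iff.1 (congrArg (dist K) h.apply_one).ge)
    (dist_pair_le_iff.1 (congrArg (dist K) h.apply_two).ge)
  refine ⟨l, fun heq => (e heq).imp_left fun ⟨k, k1, k2⟩ => ⟨k, ?_⟩⟩
  rintro x (rfl | rfl)
  exacts [k1, k2]

/-- Compact sets within the prescribed distances are solutions with exactly these distances. -/
theorem mem_solutionClass (h : IsHexBoundary 𝒜 u v)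
    (h₀ : NearPair u v ω₀ (K : Set Plane)) (h₁ : NearPair (v - u) (-u) ω₀ (K : Set Plane))
    (h₂ : NearPair (-v) (u - v) ρ₀ (K : Set Plane)) :
    K ∈ solutionClass 𝒜 ![ω₀, ω₀, ρ₀] := by
  rw [← dist_pair_le_iff, ← h.apply_zero] at h₀
  rw [← dist_pair_le_iff, ← h.apply_one] at h₁
  rw [← dist_pair_le_iff, ← h.apply_two] at h₂
  have hl := (h.classify K).1
  simp only [steinerSum, Fin.sum_univ_three] at hl
  refine ⟨fun L => le_trans ?_ (h.classify L).1, ?_⟩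
  · simp only [steinerSum, Fin.sum_univ_three]
    linarith
  -- The three upper bounds add up to the minimum of the sum, so none can be strict.
  · ext i
    fin_cases i <;> simp only [distVec] <;> apply le_antisymm <;> simp <;> linarith

theorem pair_mem_solutionClass (h : IsHexBoundary 𝒜 u v) :
    pair (t₀ • v) (t₀ • (v - u)) ∈ solutionClass 𝒜 ![ω₀, ω₀, ρ₀] := by
  obtain ⟨h₀, h₁, h₂⟩ := h.isHexPair.nearPair_pair
  exact h.mem_solutionClass h₀ h₁ h₂

theorem steinerSum_of_distVec {p q r : ℝ} (hK : distVec 𝒜 K = ![p, q, r]) :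
    steinerSum 𝒜 K = p + q + r := by
  change ∑ i, distVec 𝒜 K i = _
  simp [hK, Fin.sum_univ_three]

theorem mem_solutions_iff (h : IsHexBoundary 𝒜 u v) :
    K ∈ solutions 𝒜 ↔ steinerSum 𝒜 K = 2 * ω₀ + ρ₀ := by
  have e := steinerSum_of_distVec h.pair_mem_solutionClass.2
  constructor
  · intro hK
    linarith [hK (pair (t₀ • v) (t₀ • (v - u))), (h.classify K).1]
  · intro hK L
    rw [hK]
    exact (h.classify L).1

theorem solutions_eq (h : IsHexBoundary 𝒜 u v) :
    solutions 𝒜 = solutionClass 𝒜 ![ω₀, ω₀, ρ₀] ∪ solutionClass 𝒜 ![ρ₀, ω₀, ω₀] ∪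
      solutionClass 𝒜 ![ω₀, ρ₀, ω₀] := by
  ext K
  constructor
  · intro hK
    rcases (h.classify K).2 (h.mem_solutions_iff.1 hK) with k | k | k
    exacts [Or.inl (Or.inl ⟨hK, k.1⟩), Or.inl (Or.inr ⟨hK, k⟩), Or.inr ⟨hK, k⟩]
  · rintro ((k | k) | k) <;> exact k.1

theorem isLeast_pair (h : IsHexBoundary 𝒜 u v) :
    IsLeast (solutionClass 𝒜 ![ω₀, ω₀, ρ₀]) (pair (t₀ • v) (t₀ • (v - u))) := by
  refine ⟨h.pair_mem_solutionClass, fun K hK => ?_⟩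
  have hlt := ω₀_lt_ρ₀
  rcases (h.classify K).2 (h.mem_solutions_iff.1 hK.1) with k | k | k
  · exact k.2
  · exact absurd (congrFun (hK.2.symm.trans k) 0) (by simpa using hlt.ne)
  · exact absurd (congrFun (hK.2.symm.trans k) 1) (by simpa using hlt.ne)

theorem mem_maximalSet (h : IsHexBoundary 𝒜 u v) {x : Plane} (p q r : ℝ) :
    x ∈ maximalSet 𝒜 ![p, q, r] ↔ (dist x u ≤ p ∨ dist x v ≤ p) ∧
      (dist x (v - u) ≤ q ∨ dist x (-u) ≤ q) ∧ (dist x (-v) ≤ r ∨ dist x (u - v) ≤ r) := by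
  simp [maximalSet, Fin.forall_fin_succ, h.apply_zero, h.apply_one, h.apply_two,
    infDist_pair_le_iff]

/-- `K_d` contains every member of the class, in particular `K₀`, whose points already serve all six
vertices; membership in `K_d` supplies the other half of each Hausdorff bound. -/
theorem exists_isGreatest (h : IsHexBoundary 𝒜 u v) :
    ∃ M : NonemptyCompacts Plane, (M : Set Plane) = maximalSet 𝒜 ![ω₀, ω₀, ρ₀] ∧
      IsGreatest (solutionClass 𝒜 ![ω₀, ω₀, ρ₀]) M := by
  have hsub {K : NonemptyCompacts Plane} (hK : K ∈ solutionClass 𝒜 ![ω₀, ω₀, ρ₀]) :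
      (K : Set Plane) ⊆ maximalSet 𝒜 ![ω₀, ω₀, ρ₀] := by
    intro x hx
    have d0 : dist K (𝒜 0) = ω₀ := congrFun hK.2 0
    have d1 : dist K (𝒜 1) = ω₀ := congrFun hK.2 1
    have d2 : dist K (𝒜 2) = ρ₀ := congrFun hK.2 2
    rw [h.apply_zero] at d0
    rw [h.apply_one] at d1
    rw [h.apply_two] at d2
    exact (h.mem_maximalSet _ _ _).2 ⟨(dist_pair_le_iff.1 d0.le).mem x hx,
      (dist_pair_le_iff.1 d1.le).mem x hx, (dist_pair_le_iff.1 d2.le).mem x hx⟩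
  have hp := hsub h.pair_mem_solutionClass
  let M : NonemptyCompacts Plane :=
    ⟨⟨maximalSet 𝒜 ![ω₀, ω₀, ρ₀], isCompact_maximalSet _ _⟩, ⟨_, hp (Or.inl rfl)⟩⟩
  have hM {x : Plane} (hx : x ∈ (M : Set Plane)) := (h.mem_maximalSet _ _ _).1 hx
  exact ⟨M, rfl, h.mem_solutionClass
    (h.isHexPair.nearPair_left hp fun x hx => (hM hx).1)
    (h.isHexPair.nearPair_middle hp fun x hx => (hM hx).2.1)
    (h.isHexPair.nearPair_right hp fun x hx => (hM hx).2.2), fun K hK => hsub hK⟩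

/-- The rotation is an isometry carrying each boundary set to the next one cyclically. -/
theorem distVec_rotCompact (h : IsHexBoundary 𝒜 u v) {p q r : ℝ} :
    distVec 𝒜 (rotCompact (2 * Real.pi / 3) K) = ![r, p, q] ↔ distVec 𝒜 K = ![p, q, r] := by
  have e0 : rotCompact (2 * Real.pi / 3) (𝒜 0) = 𝒜 1 := by
    rw [h.apply_zero, h.apply_one, rotCompact_pair, h.rot_left, h.rot_right]
  have e1 : rotCompact (2 * Real.pi / 3) (𝒜 1) = 𝒜 2 := by
    rw [h.apply_one, h.apply_two, rotCompact_pair, rot_sub, rot_neg, h.rot_left, h.rot_right,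
      neg_sub_sub, neg_sub]
  have e2 : rotCompact (2 * Real.pi / 3) (𝒜 2) = 𝒜 0 := by
    rw [h.apply_two, h.apply_zero, rotCompact_pair, rot_sub, rot_neg, h.rot_left, h.rot_right,
      neg_neg, sub_neg_eq_add, sub_add_cancel]
  have d (i) : dist (rotCompact (2 * Real.pi / 3) K) (rotCompact (2 * Real.pi / 3) (𝒜 i)) =
      dist K (𝒜 i) := dist_rotCompact _ _ _
  have d0 := d 0
  have d1 := d 1
  have d2 := d 2
  rw [e0] at d0
  rw [e1] at d1
  rw [e2] at d2
  simp [funext_iff, Fin.forall_fin_succ, distVec, d0, d1, d2]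
  tauto

theorem solutionClass_rotate (h : IsHexBoundary 𝒜 u v) (p q r : ℝ) :
    solutionClass 𝒜 ![r, p, q] =
      rotCompact (2 * Real.pi / 3) '' solutionClass 𝒜 ![p, q, r] := by
  ext K
  constructor
  · rintro ⟨h1, h2⟩
    have hK : rotCompact (2 * Real.pi / 3) (rotCompact (4 * Real.pi / 3) K) = K := by
      rw [rotCompact_rotCompact, ← add_div, ← add_mul, show (2 + 4) * Real.pi / 3 = 2 * Real.pi by
        ring, rotCompact_two_pi]
    refine ⟨_, ?_, hK⟩
    rw [← hK, h.distVec_rotCompact] at h2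
    refine ⟨?_, h2⟩
    rw [h.mem_solutions_iff] at h1 ⊢
    rw [← hK, steinerSum_of_distVec (h.distVec_rotCompact.2 h2)] at h1
    rw [steinerSum_of_distVec h2]
    linarith
  · rintro ⟨L, ⟨h1, h2⟩, rfl⟩
    refine ⟨?_, h.distVec_rotCompact.2 h2⟩
    rw [h.mem_solutions_iff] at h1 ⊢
    rw [steinerSum_of_distVec (h.distVec_rotCompact.2 h2)]
    rw [steinerSum_of_distVec h2] at h1
    linarith

theorem solutionClass_rotate_rotate (h : IsHexBoundary 𝒜 u v) (p q r : ℝ) :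
    solutionClass 𝒜 ![q, r, p] =
      rotCompact (4 * Real.pi / 3) '' solutionClass 𝒜 ![p, q, r] := by
  rw [h.solutionClass_rotate, h.solutionClass_rotate, Set.image_image]
  simp only [rotCompact_rotCompact]
  rw [show 2 * Real.pi / 3 + 2 * Real.pi / 3 = 4 * Real.pi / 3 by ring]

theorem distVecs_eq (h : IsHexBoundary 𝒜 u v) :
    distVecs 𝒜 = {![ω₀, ω₀, ρ₀], ![ρ₀, ω₀, ω₀], ![ω₀, ρ₀, ω₀]} := by
  have mem {d : Fin 3 → ℝ} : d ∈ distVecs 𝒜 ↔ (solutionClass 𝒜 d).Nonempty := Iff.rfl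
  have hp : (solutionClass 𝒜 ![ω₀, ω₀, ρ₀]).Nonempty := ⟨_, h.pair_mem_solutionClass⟩
  ext d
  constructor
  · rintro ⟨K, hK, rfl⟩
    rw [h.solutions_eq] at hK
    rcases hK with (k | k) | k
    exacts [Or.inl k.2, Or.inr (Or.inl k.2), Or.inr (Or.inr k.2)]
  · rintro (rfl | rfl | rfl)
    · exact mem.2 hp
    · rw [mem, h.solutionClass_rotate]
      exact hp.image _
    · rw [mem, h.solutionClass_rotate_rotate]
      exact hp.image _

theorem ncard_distVecs (h : IsHexBoundary 𝒜 u v) : (distVecs 𝒜).ncard = 3 := by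
  have hlt := ω₀_lt_ρ₀.ne
  rw [Set.ncard_eq_three]
  refine ⟨_, _, _, ?_, ?_, ?_, h.distVecs_eq⟩ <;>
    simp [funext_iff, Fin.forall_fin_succ, hlt, hlt.symm]

end IsHexBoundary

theorem pairwiseDisjoint_solutionClass {Y : Type*} [MetricSpace Y] {n : ℕ} (𝒜 : Fin n → Y)
    (s : Set (Fin n → ℝ)) : s.PairwiseDisjoint (solutionClass 𝒜) := by
  intro d _ e _ hne
  rw [Function.onFun, Set.disjoint_left]
  intro y hd he
  exact hne (hd.2.symm.trans he.2)

theorem IsHexPair.isClosestIntersection_iff {u v : Plane} (h : IsHexPair u v) (k : Plane) :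
    IsClosestIntersection ω₀ u (v - u) k ↔ k = t₀ • v := by
  have hn : ‖t₀ • v‖ = t₀ := by
    rw [norm_smul, h.norm_right, mul_one, Real.norm_of_nonneg t₀_pos.le]
  have hmem : t₀ • v ∈ Metric.sphere u ω₀ ∩ Metric.sphere (v - u) ω₀ := ⟨h.dist_left, h.dist_sub⟩
  simp only [IsClosestIntersection, dist_zero_left]
  constructor
  · rintro ⟨⟨h1, h2⟩, h3⟩
    exact (h.t₀_le_norm h1 h2).2 ((h3 _ hmem).trans_eq hn)
  · rintro rfl
    exact ⟨hmem, fun k' hk' => hn.trans_le (h.t₀_le_norm hk'.1 hk'.2).1⟩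

theorem smul_mem_segment_zero {E : Type*} [AddCommGroup E] [Module ℝ E] (x : E) {t : ℝ}
    (h0 : 0 ≤ t) (h1 : t ≤ 1) : t • x ∈ segment ℝ 0 x :=
  ⟨1 - t, t, by linarith, h0, by ring, by simp⟩

end FermatSteiner

open FermatSteiner
theorem mainTheorem2 (a b : Fin 3 → Plane) (𝒜 : Fin 3 → NonemptyCompacts Plane)
    (ha₀ : ‖a 0‖ = 1)
    (ha₁ : a 1 = rot (2 * Real.pi / 3) (a 0))
    (ha₂ : a 2 = rot (4 * Real.pi / 3) (a 0))
    (hb : ∀ i, b i = rot (Real.pi / 3) (a i))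
    (h𝒜 : ∀ i, 𝒜 i = pair (a i) (b i)) :
    ∃ ka kb : Plane,
      -- the points which form `K₀`
      (∀ k, IsClosestIntersection ω₀ (a 0) (a 1) k ↔ k = ka) ∧
      (∀ k, IsClosestIntersection ω₀ (b 0) (b 1) k ↔ k = kb) ∧
      ka ∈ segment ℝ 0 (b 0) ∧ kb ∈ segment ℝ 0 (a 1) ∧
      dist 0 ka = t₀ ∧ dist 0 kb = t₀ ∧
      -- `K₀` is a Steiner compact with the given distances
      pair ka kb ∈ solutionClass 𝒜 ![ω₀, ω₀, ρ₀] ∧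
      steinerSum 𝒜 (pair ka kb) = 2 * ω₀ + ρ₀ ∧
      2 * ω₀ + ρ₀ = √(35 / 8 + 3 / 8 * √(-47 + 80 * √5)) ∧
      |2 * ω₀ + ρ₀ - 2.94645| < 0.000005 ∧ 2 * ω₀ + ρ₀ < 3 ∧
      -- `K₀` is the unique minimal Steiner compact of its class
      (∀ K, Minimal (· ∈ solutionClass 𝒜 ![ω₀, ω₀, ρ₀]) K ↔ K = pair ka kb) ∧
      -- the unique maximal Steiner compact of the class
      (∃ M : NonemptyCompacts Plane, (M : Set Plane) = maximalSet 𝒜 ![ω₀, ω₀, ρ₀] ∧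
        ∀ K, Maximal (· ∈ solutionClass 𝒜 ![ω₀, ω₀, ρ₀]) K ↔ K = M) ∧
      -- the three classes
      distVecs 𝒜 = {![ω₀, ω₀, ρ₀], ![ρ₀, ω₀, ω₀], ![ω₀, ρ₀, ω₀]} ∧
      (distVecs 𝒜).ncard = 3 ∧
      solutions 𝒜 = solutionClass 𝒜 ![ω₀, ω₀, ρ₀] ∪ solutionClass 𝒜 ![ρ₀, ω₀, ω₀] ∪
        solutionClass 𝒜 ![ω₀, ρ₀, ω₀] ∧
      (distVecs 𝒜).PairwiseDisjoint (solutionClass 𝒜) ∧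
      solutionClass 𝒜 ![ρ₀, ω₀, ω₀] =
        rotCompact (2 * Real.pi / 3) '' solutionClass 𝒜 ![ω₀, ω₀, ρ₀] ∧
      solutionClass 𝒜 ![ω₀, ρ₀, ω₀] =
        rotCompact (4 * Real.pi / 3) '' solutionClass 𝒜 ![ω₀, ω₀, ρ₀] := by
  have hu := isHexPair_rot ha₀
  have hb0 := hb 0
  have hb1 := hb 1
  have hb2 := hb 2
  set u := a 0
  set v := rot (Real.pi / 3) u with hv
  have hvr : rot (Real.pi / 3) v = v - u := rot_pi_div_three_rot u
  have hwr : rot (Real.pi / 3) (v - u) = -u := by rw [rot_sub, hvr, ← hv]; abel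
  rw [rot_two_pi_div_three, ← hv] at ha₁
  rw [rot_four_pi_div_three, ← hv] at ha₂
  rw [ha₁, hwr] at hb1
  rw [ha₂, rot_neg, hvr, neg_sub] at hb2
  have h : IsHexBoundary 𝒜 u v :=
    { isHexPair := hu
      rot_left := rot_two_pi_div_three u
      rot_right := by rw [rot_two_pi_div_three, hvr]; abel
      apply_zero := by rw [h𝒜, hb0]
      apply_one := by rw [h𝒜, ha₁, hb1]
      apply_two := by rw [h𝒜, ha₂, hb2] }
  have hnorm {x : Plane} (hx : ‖x‖ = 1) : dist 0 (t₀ • x) = t₀ := by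
    rw [dist_zero_left, norm_smul, hx, mul_one, Real.norm_of_nonneg t₀_pos.le]
  have ht := t₀_lt_half
  obtain ⟨M, hM, hM'⟩ := h.exists_isGreatest
  rw [ha₁, hb0, hb1]
  refine ⟨t₀ • v, t₀ • (v - u), hu.isClosestIntersection_iff, ?_,
    smul_mem_segment_zero _ t₀_pos.le (by linarith),
    smul_mem_segment_zero _ t₀_pos.le (by linarith), hnorm hu.norm_right,
    hnorm hu.rotate.norm_left, h.pair_mem_solutionClass,
    h.mem_solutions_iff.1 h.pair_mem_solutionClass.1, total_eq, abs_total_sub_lt, total_lt_three,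
    fun K => h.isLeast_pair.minimal_iff, ⟨M, hM, fun K => hM'.maximal_iff⟩, h.distVecs_eq,
    h.ncard_distVecs, h.solutions_eq, pairwiseDisjoint_solutionClass 𝒜 _,
    h.solutionClass_rotate _ _ _, h.solutionClass_rotate_rotate _ _ _⟩
  intro k
  -- The circles about `b 0 = v` and `b 1 = -u` are those of the reflected pair, taken in the
  -- opposite order.
  have := hu.reflect.isClosestIntersection_iff k
  rw [sub_neg_eq_add, sub_add_cancel] at this
  rw [← this]
  simp only [IsClosestIntersection, Set.inter_comm]
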